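/- Let $G$ be a finite simple graph without isolated vertices, with vertex set $V_G$ and edge set $E_G$, and let $K$ be a field. Let $K[V_G]=K[x_i : i\in V_G]$ and $K[E_G]=K[t_e : e\in E_G]$ be the standard graded polynomial rings on the vertices and on the edges, let $\theta\colon K[E_G]\to K[V_G]$ be the $K$-algebra homomorphism with $\theta(t_e)=x_ix_j$ for every edge $e=\{i,j\}$, and let $$I(X_G)=\theta^{-1}\bigl((x_i^2-x_j^2 : i,j\in V_G)\bigr),$$ a homogeneous ideal of $K[E_G]$. A join of $G$ is a set of edges $J\subseteq E_G$ such that $|J\cap E_C|\le |E_C|/2$ for every circuit (cycle) $C$ of $G$, where $E_C$ is the set of edges of $C$; let $\mu(G)$ be the maximum cardinality of a join of $G$. For a nonzero finitely generated graded module $M$ over a polynomial ring over $K$ in finitely many variables, with graded Betti numbers $\beta_{ij}(M)$ (the number of generators of degree $j$ of the $i$-th free module in a minimal graded free resolution of $M$), let $\operatorname{reg} M=\max\{j-i : \beta_{ij}(M)\neq 0\}$ be its Castelnuovo--Mumford regularity; for the zero ideal the convention $\operatorname{reg}(0)=1$ is used, in agreement with $\operatorname{reg} I=\operatorname{reg}(K[E_G]/I)+1$.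 Then $$\operatorname{reg} I(X_G)\ \ge\ \mu(G).$$ -/

import Mathlib

noncomputable section

namespace JoinReg

/-! ### Graded free resolutions over a polynomial ring and regularity -/

/-- Let `F` be the free module with basis `b`, the basis element `b` being placed in degree
`deg b`, over the standard graded polynomial ring. A vector is homogeneous of degree `j` when
each of its coordinates `v b` is homogeneous of degree `j - deg b` (and `0` if `j < deg b`). -/
def IsFreeHomogeneous {σ K ι : Type*} [Field K] (deg : ι → ℕ) (j : ℕ)
    (v : ι → MvPolynomial σ K) : Prop :=
  ∀ b, ∀ m ∈ (v b).support, deg b + m.degree = j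

/-- A minimal graded free resolution
`⋯ → F₂ → F₁ → F₀ → M → 0`
(with finitely generated `Fᵢ`) of an `ℕ`-graded module `M` over the polynomial ring `K[σ]`;
`ℳ j` is the component of degree `j` of `M`. Here `Fᵢ = ⨁_b K[σ](-deg i b)`. -/
structure MinimalGradedFreeResolution {σ K M : Type*} [Field K] [AddCommGroup M]
    [Module (MvPolynomial σ K) M] (ℳ : ℕ → AddSubgroup M) where
  /-- the rank of `Fᵢ` -/
  rank : ℕ → ℕ
  /-- the degrees of the basis elements of `Fᵢ` -/
  deg : ∀ i, Fin (rank i) → ℕ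
  /-- the differential `Fᵢ₊₁ → Fᵢ` -/
  d : ∀ i, (Fin (rank (i + 1)) → MvPolynomial σ K) →ₗ[MvPolynomial σ K]
    (Fin (rank i) → MvPolynomial σ K)
  /-- the augmentation `F₀ → M` -/
  ε : (Fin (rank 0) → MvPolynomial σ K) →ₗ[MvPolynomial σ K] M
  /-- the differentials are homogeneous of degree `0` -/
  d_deg : ∀ i b, IsFreeHomogeneous (deg i) (deg (i + 1) b) (d i (Pi.single b 1))
  /-- the augmentation is homogeneous of degree `0` -/
  ε_deg : ∀ b, ε (Pi.single b 1) ∈ ℳ (deg 0 b)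
  ε_surjective : Function.Surjective ε
  exact_zero : Function.Exact (d 0) ε
  exact_succ : ∀ i, Function.Exact (d (i + 1)) (d i)
  /-- minimality: the image of `Fᵢ₊₁ → Fᵢ` is contained in `𝔪 Fᵢ`, where `𝔪` is the ideal
  generated by the variables -/
  minimal : ∀ i v b, MvPolynomial.constantCoeff (d i v b) = 0

/-- The number of basis elements of degree `j` in the `i`-th free module. -/
def MinimalGradedFreeResolution.betti {σ K M : Type*} [Field K] [AddCommGroup M]
    [Module (MvPolynomial σ K) M] {ℳ : ℕ → AddSubgroup M}
    (F : MinimalGradedFreeResolution (σ := σ) (K := K) ℳ) (i j : ℕ) : ℕ :=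
  Nat.card {b : Fin (F.rank i) // F.deg i b = j}

open Classical in
/-- The graded Betti number `β_{ij}(M)`, read off a minimal graded free resolution of `M`.
Such a resolution exists and is unique up to isomorphism for a finitely generated graded module
over a polynomial ring in finitely many variables; the value `0` is used if there is none. -/
def gradedBetti (σ K : Type*) {M : Type*} [Field K] [AddCommGroup M]
    [Module (MvPolynomial σ K) M] (ℳ : ℕ → AddSubgroup M) (i j : ℕ) : ℕ :=
  if h : Nonempty (MinimalGradedFreeResolution (σ := σ) (K := K) ℳ) then
    (Classical.choice h).betti i j
  else 0

/-- Castelnuovo--Mumford regularity: `reg M = max {j - i : β_{ij}(M) ≠ 0}`. -/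
def regularity (σ K : Type*) {M : Type*} [Field K] [AddCommGroup M]
    [Module (MvPolynomial σ K) M] (ℳ : ℕ → AddSubgroup M) : EReal :=
  ⨆ (i : ℕ) (j : ℕ) (_ : gradedBetti σ K ℳ i j ≠ 0), (((j : ℝ) - (i : ℝ) : ℝ) : EReal)

/-- The grading of an ideal by degree: its elements that are homogeneous of degree `j`. -/
def idealGrading {σ K : Type*} [Field K] (I : Ideal (MvPolynomial σ K)) (j : ℕ) :
    AddSubgroup I :=
  (MvPolynomial.homogeneousSubmodule σ K j).toAddSubgroup.comap I.subtype.toAddMonoidHom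

open Classical in
/-- The regularity of a homogeneous ideal `I`, viewed as a graded module. For `I = 0`, which has
no nonzero Betti number, the convention is `reg 0 = 1`, so that `reg I = reg (K[σ]/I) + 1` holds
for every proper homogeneous ideal. -/
def idealRegularity {σ K : Type*} [Field K] (I : Ideal (MvPolynomial σ K)) : EReal :=
  if I = ⊥ then 1 else regularity σ K (idealGrading I)

/-! ### The ideal of a graph -/

/-- `θ : K[E_G] → K[V_G]`, `t_e ↦ x_i x_j` for `e = {i, j}`. -/
def theta {V : Type*} (K : Type*) [Field K] (G : SimpleGraph V) :
    MvPolynomial G.edgeSet K →ₐ[K] MvPolynomial V K :=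
  MvPolynomial.aeval fun e : G.edgeSet =>
    Sym2.lift ⟨fun i j => (MvPolynomial.X i * MvPolynomial.X j : MvPolynomial V K),
      fun _ _ => mul_comm _ _⟩ (e : Sym2 V)

/-- `I(X_G) = θ⁻¹ (x_i² - x_j² : i, j ∈ V_G)`. -/
def graphIdeal {V : Type*} (K : Type*) [Field K] (G : SimpleGraph V) :
    Ideal (MvPolynomial G.edgeSet K) :=
  (Ideal.span {p : MvPolynomial V K |
    ∃ i j : V, p = MvPolynomial.X i ^ 2 - MvPolynomial.X j ^ 2}).comap (theta K G)

/-! ### Joins -/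

open Classical in
/-- A join: a set of edges that contains at most half of the edges of each circuit. -/
def IsJoin {V : Type*} (G : SimpleGraph V) (J : Finset (Sym2 V)) : Prop :=
  (J : Set (Sym2 V)) ⊆ G.edgeSet ∧
    ∀ (v : V) (c : G.Walk v v), c.IsCycle → 2 * (J ∩ c.edges.toFinset).card ≤ c.length

/-- The maximum vertex join number: the maximum cardinality of a join. -/
def maxJoinNumber {V : Type*} (G : SimpleGraph V) : ℕ :=
  sSup {k : ℕ | ∃ J : Finset (Sym2 V), IsJoin G J ∧ J.card = k}

end JoinReg

end

/-!
Multiplication by an edge variable `X e` is injective modulo `I = I(X_G)`, so the socle of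
`K[E_G] / (I, X e)` is visible in the minimal free resolution of `I`: multiplying a socle element of
degree `n` by the remaining variables one after the other and lifting along the differentials
produces a basis element of large degree in the last free module, which gives `reg I ≥ n + 1`.

It remains to find a socle element of degree at least `μ(G) - 1`. Modulo `(x_i² - x_j²)` a monomial
is determined by its degree and the parities of its exponents, so `I` is the kernel of a monomial
map to the group algebra of `ℤ × 𝔽₂^V`. If the product of the edges of `J \ {e}`, for a maximum join
`J ∋ e`, were congruent to a multiple of `X e`, the symmetric difference of `J \ {e}` and the edges
of odd exponent in that multiple would be an edge-disjoint union of circuits, and counting the edges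
of `J` on these circuits gives a contradiction. Since the squares of all variables lie in
`(I, X e)`, this monomial has a multiple in the socle.
-/

noncomputable section

namespace JoinReg

open MvPolynomial

/-! ### Graded free modules -/

section GradedFree

variable {σ K ι κ : Type*} [Field K]

/-- The projection of the graded free module with basis degrees `deg` onto its component of
degree `j`. -/
def freeComponent (deg : ι → ℕ) (j : ℕ) :
    (ι → MvPolynomial σ K) →ₗ[K] (ι → MvPolynomial σ K) :=
  LinearMap.pi fun b =>
    if deg b ≤ j then homogeneousComponent (j - deg b) ∘ₗ LinearMap.proj b else 0

lemma coeff_freeComponent (deg : ι → ℕ) (j : ℕ) (v : ι → MvPolynomial σ K) (b : ι) (m : σ →₀ ℕ) :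
    coeff m (freeComponent deg j v b) = if deg b + m.degree = j then coeff m (v b) else 0 := by
  rw [freeComponent, LinearMap.pi_apply]
  by_cases h : deg b ≤ j
  · rw [if_pos h, LinearMap.comp_apply, LinearMap.proj_apply, coeff_homogeneousComponent]
    exact if_congr (by omega) rfl rfl
  · rw [if_neg h, if_neg (by omega), LinearMap.zero_apply, coeff_zero]

lemma freeComponent_apply_of_deg_eq {deg : ι → ℕ} {j : ℕ} {b : ι} (h : deg b = j)
    (v : ι → MvPolynomial σ K) : freeComponent deg j v b = C (constantCoeff (v b)) := by
  classical
  ext m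
  rw [coeff_freeComponent, coeff_C, constantCoeff_eq]
  by_cases hm : m = 0
  · simp [hm, h]
  · rw [if_neg (by simpa [h, Finsupp.degree_eq_zero_iff] using hm), if_neg (Ne.symm hm)]

lemma isFreeHomogeneous_freeComponent (deg : ι → ℕ) (j : ℕ) (v : ι → MvPolynomial σ K) :
    IsFreeHomogeneous deg j (freeComponent deg j v) := by
  intro b m hm
  rw [mem_support_iff, coeff_freeComponent] at hm
  exact of_not_not fun h => hm (if_neg h)

lemma IsFreeHomogeneous.freeComponent_eq {deg : ι → ℕ} {j : ℕ} {v : ι → MvPolynomial σ K}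
    (hv : IsFreeHomogeneous deg j v) (k : ℕ) :
    freeComponent deg k v = if j = k then v else 0 := by
  ext b m
  rw [coeff_freeComponent]
  by_cases h0 : coeff m (v b) = 0
  · split_ifs <;> simp [h0]
  · have := hv b m (mem_support_iff.2 h0)
    split_ifs <;> first | rfl | omega

lemma IsFreeHomogeneous.freeComponent_self {deg : ι → ℕ} {j : ℕ} {v : ι → MvPolynomial σ K}
    (hv : IsFreeHomogeneous deg j v) : freeComponent deg j v = v := by
  rw [hv.freeComponent_eq, if_pos rfl]

lemma IsFreeHomogeneous.monomial_smul {deg : ι → ℕ} {j : ℕ} {v : ι → MvPolynomial σ K}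
    (hv : IsFreeHomogeneous deg j v) (m : σ →₀ ℕ) (c : K) :
    IsFreeHomogeneous deg (j + m.degree) (monomial m c • v) := by
  classical
  intro b n hn
  rw [Pi.smul_apply, smul_eq_mul, mem_support_iff, coeff_monomial_mul', ite_ne_right_iff] at hn
  have hdeg := hv b _ (mem_support_iff.2 (right_ne_zero_of_mul hn.2))
  have hn_degree : n.degree = (n - m).degree + m.degree := by
    rw [← map_add, tsub_add_cancel_of_le hn.1]
  omega

lemma isFreeHomogeneous_single [DecidableEq ι] (deg : ι → ℕ) (b : ι) :
    IsFreeHomogeneous deg (deg b) (Pi.single b (1 : MvPolynomial σ K)) := by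
  intro b' m hm
  obtain rfl | hb := eq_or_ne b' b
  · rw [Pi.single_eq_same] at hm
    simp [Finset.mem_singleton.1 (support_monomial_subset hm)]
  · simp [Pi.single_eq_of_ne hb] at hm

lemma isFreeHomogeneous_zero_iff {j : ℕ} {v : ι → MvPolynomial σ K} :
    IsFreeHomogeneous (fun _ => 0) j v ↔ ∀ b, (v b).IsHomogeneous j := by
  simp only [IsFreeHomogeneous, IsHomogeneous, IsWeightedHomogeneous, zero_add, mem_support_iff,
    Finsupp.degree_eq_weight_one]
  rfl

lemma exists_sum_freeComponent_eq [Finite ι] (deg : ι → ℕ) (v : ι → MvPolynomial σ K) :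
    ∃ N, ∑ j ∈ Finset.range N, freeComponent deg j v = v := by
  classical
  cases nonempty_fintype ι
  obtain ⟨N, hN⟩ := (Finset.univ.biUnion fun b =>
    (v b).support.image fun m => deg b + m.degree).bddAbove
  refine ⟨N + 1, ?_⟩
  ext b m
  rw [Finset.sum_apply, coeff_sum]
  simp only [coeff_freeComponent, Finset.sum_ite_eq, ite_eq_left_iff]
  refine fun hm => (notMem_support_iff.1 fun hmem => hm ?_).symm
  exact Finset.mem_range_succ_iff.2 (hN (Finset.mem_biUnion.2
    ⟨b, Finset.mem_univ b, Finset.mem_image_of_mem _ hmem⟩))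

lemma freeComponent_map [Finite ι] [DecidableEq ι] {deg : ι → ℕ} {deg' : κ → ℕ}
    {d : (ι → MvPolynomial σ K) →ₗ[MvPolynomial σ K] (κ → MvPolynomial σ K)}
    (hd : ∀ b, IsFreeHomogeneous deg' (deg b) (d (Pi.single b 1))) (j : ℕ)
    (v : ι → MvPolynomial σ K) :
    freeComponent deg' j (d v) = d (freeComponent deg j v) := by
  suffices freeComponent deg' j ∘ₗ d.restrictScalars K =
      d.restrictScalars K ∘ₗ freeComponent deg j from LinearMap.congr_fun this v
  refine LinearMap.pi_ext' fun b => linearMap_ext fun m => LinearMap.ext fun c => ?_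
  have hsingle : (Pi.single b (monomial m c) : ι → MvPolynomial σ K) =
      monomial m c • Pi.single b 1 := by
    rw [← Pi.single_smul, smul_eq_mul, mul_one]
  simp only [LinearMap.comp_apply, LinearMap.single_apply, LinearMap.restrictScalars_apply,
    hsingle, map_smul, ((hd b).monomial_smul m c).freeComponent_eq,
    ((isFreeHomogeneous_single deg b).monomial_smul m c).freeComponent_eq]
  split_ifs
  · rw [map_smul]
  · rw [map_zero]

/-- A submodule of a graded free module is homogeneous if it contains the components of its
elements. -/
def IsHomogeneousSubmodule (deg : ι → ℕ)
    (N : Submodule (MvPolynomial σ K) (ι → MvPolynomial σ K)) : Prop :=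
  ∀ v ∈ N, ∀ j, freeComponent deg j v ∈ N

lemma isHomogeneousSubmodule_ker [Finite ι] [DecidableEq ι] {deg : ι → ℕ} {deg' : κ → ℕ}
    {d : (ι → MvPolynomial σ K) →ₗ[MvPolynomial σ K] (κ → MvPolynomial σ K)}
    (hd : ∀ b, IsFreeHomogeneous deg' (deg b) (d (Pi.single b 1))) :
    IsHomogeneousSubmodule deg (LinearMap.ker d) := by
  intro v hv j
  rw [LinearMap.mem_ker, ← freeComponent_map hd, LinearMap.mem_ker.1 hv, map_zero]

lemma IsHomogeneousSubmodule.span_homogeneous_eq [Finite ι] {deg : ι → ℕ}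
    {N : Submodule (MvPolynomial σ K) (ι → MvPolynomial σ K)} (hN : IsHomogeneousSubmodule deg N) :
    Submodule.span (MvPolynomial σ K) {v ∈ N | ∃ j, IsFreeHomogeneous deg j v} = N := by
  refine le_antisymm (Submodule.span_le.2 fun v hv => hv.1) fun v hv => ?_
  obtain ⟨B, hB⟩ := exists_sum_freeComponent_eq deg v
  rw [← hB]
  exact Submodule.sum_mem _ fun j _ =>
    Submodule.subset_span ⟨hN v hv j, j, isFreeHomogeneous_freeComponent _ _ _⟩

end GradedFree

/-! ### Existence of minimal graded free resolutions -/

section Existence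

variable {σ K ι κ : Type*} [Field K]

lemma exists_irredundant_finset_span_eq {R M : Type*} [Ring R] [AddCommGroup M] [Module R M]
    [IsNoetherian R M] (s : Set M) :
    ∃ t : Finset M, ↑t ⊆ s ∧ Submodule.span R (t : Set M) = Submodule.span R s ∧
      ∀ v ∈ t, v ∉ Submodule.span R (t \ {v} : Set M) := by
  classical
  obtain ⟨t₀, ht₀, hspan₀⟩ := (Submodule.fg_span_iff_fg_span_finset_subset s).1
    (IsNoetherian.noetherian (Submodule.span R s))
  obtain ⟨t, htt₀, hspan, hmin⟩ := exists_minimal_le_of_wellFoundedLT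
    (fun t : Finset M => Submodule.span R (t : Set M) = Submodule.span R s) t₀ hspan₀.symm
  refine ⟨t, (Finset.coe_subset.2 htt₀).trans ht₀, hspan, fun v hv hv_span => ?_⟩
  have herase : Submodule.span R ((t.erase v : Finset M) : Set M) = Submodule.span R s := by
    rw [Finset.coe_erase, ← Submodule.span_insert_eq_span hv_span, Set.insert_sdiff_singleton,
      Set.insert_eq_of_mem (Finset.mem_coe.2 hv), hspan]
  exact Finset.notMem_erase v t (hmin herase (Finset.erase_subset v t) hv)

lemma constantCoeff_eq_zero_of_linearCombination_eq_zero [Fintype κ] {deg : ι → ℕ}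
    {deg' : κ → ℕ} {v : κ → ι → MvPolynomial σ K}
    (hdeg : ∀ b, IsFreeHomogeneous deg (deg' b) (v b))
    (hv : ∀ b, v b ∉ Submodule.span (MvPolynomial σ K) (v '' {b}ᶜ))
    {c : κ → MvPolynomial σ K} (hc : Fintype.linearCombination (MvPolynomial σ K) v c = 0)
    (b : κ) : constantCoeff (c b) = 0 := by
  classical
  by_contra hne
  have hd : ∀ a, IsFreeHomogeneous deg (deg' a)
      (Fintype.linearCombination (MvPolynomial σ K) v (Pi.single a 1)) := fun a => by
    rw [Fintype.linearCombination_apply_single, one_smul]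
    exact hdeg a
  have hcomponent : ∑ a, freeComponent deg' (deg' b) c a • v a = 0 := by
    rw [← Fintype.linearCombination_apply, ← freeComponent_map hd, hc, map_zero]
  rw [← Finset.add_sum_erase _ _ (Finset.mem_univ b), freeComponent_apply_of_deg_eq rfl]
    at hcomponent
  have hunit : IsUnit (C (constantCoeff (c b)) : MvPolynomial σ K) := (IsUnit.mk0 _ hne).map C
  refine hv b ((Submodule.smul_mem_iff_of_isUnit _ hunit).1 ?_)
  rw [eq_neg_of_add_eq_zero_left hcomponent]
  exact Submodule.neg_mem _ (Submodule.sum_mem _ fun a ha => Submodule.smul_mem _ _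
    (Submodule.subset_span (Set.mem_image_of_mem v (Finset.ne_of_mem_erase ha))))

variable [Finite σ]

lemma IsHomogeneousSubmodule.exists_minimal_generators [Finite ι] {deg : ι → ℕ}
    {N : Submodule (MvPolynomial σ K) (ι → MvPolynomial σ K)} (hN : IsHomogeneousSubmodule deg N) :
    ∃ (k : ℕ) (deg' : Fin k → ℕ)
      (d : (Fin k → MvPolynomial σ K) →ₗ[MvPolynomial σ K] (ι → MvPolynomial σ K)),
      (∀ b, IsFreeHomogeneous deg (deg' b) (d (Pi.single b 1))) ∧ LinearMap.range d = N ∧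
        ∀ c ∈ LinearMap.ker d, ∀ b, constantCoeff (c b) = 0 := by
  classical
  obtain ⟨t, ht, hspan, hirr⟩ := exists_irredundant_finset_span_eq
    (R := MvPolynomial σ K) {v ∈ N | ∃ j, IsFreeHomogeneous deg j v}
  choose deg' hdeg' using fun v : t => (ht v.2).2
  let v : Fin t.card → ι → MvPolynomial σ K := fun b => t.equivFin.symm b
  have hv_injective : Function.Injective v :=
    Subtype.val_injective.comp t.equivFin.symm.injective
  have hv_range : Set.range v = t :=
    (t.equivFin.symm.surjective.range_comp Subtype.val).trans Subtype.range_coe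
  refine ⟨t.card, fun b => deg' (t.equivFin.symm b), Fintype.linearCombination _ v,
    fun b => ?_, ?_, fun c hc => ?_⟩
  · rw [Fintype.linearCombination_apply_single, one_smul]
    exact hdeg' _
  · rw [Fintype.range_linearCombination, hv_range, hspan, hN.span_homogeneous_eq]
  · refine constantCoeff_eq_zero_of_linearCombination_eq_zero (fun b => hdeg' _) (fun b => ?_) hc
    rw [Set.image_compl_eq_range_sdiff_image hv_injective, Set.image_singleton, hv_range]
    exact hirr _ (Subtype.coe_prop _)

variable (σ K) in
/-- A homogeneous submodule of a graded free module of finite rank: the syzygy module that remains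
to be resolved when a free resolution is built step by step. -/
structure SyzygyModule where
  rank : ℕ
  deg : Fin rank → ℕ
  syz : Submodule (MvPolynomial σ K) (Fin rank → MvPolynomial σ K)
  homogeneous : IsHomogeneousSubmodule deg syz

lemma SyzygyModule.exists_minimal_presentation (s : SyzygyModule σ K) :
    ∃ (t : SyzygyModule σ K) (d : (Fin t.rank → MvPolynomial σ K) →ₗ[MvPolynomial σ K]
        (Fin s.rank → MvPolynomial σ K)),
      (∀ b, IsFreeHomogeneous s.deg (t.deg b) (d (Pi.single b 1))) ∧ LinearMap.range d = s.syz ∧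
        LinearMap.ker d = t.syz ∧ ∀ c ∈ t.syz, ∀ b, constantCoeff (c b) = 0 := by
  obtain ⟨k, deg', d, hdeg, hrange, hmin⟩ := s.homogeneous.exists_minimal_generators
  exact ⟨⟨k, deg', LinearMap.ker d, isHomogeneousSubmodule_ker hdeg⟩, d, hdeg, hrange, rfl, hmin⟩

theorem nonempty_minimalGradedFreeResolution {I : Ideal (MvPolynomial σ K)}
    (hI : ∀ f ∈ I, ∀ j, homogeneousComponent j f ∈ I) :
    Nonempty (MinimalGradedFreeResolution (σ := σ) (K := K) (idealGrading I)) := by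
  let s₀ : SyzygyModule σ K := ⟨1, fun _ => 0, Submodule.comap (LinearMap.proj 0) I,
    fun v hv j => by simpa [freeComponent] using hI _ hv j⟩
  choose next d hdeg hrange hker hmin using
    SyzygyModule.exists_minimal_presentation (σ := σ) (K := K)
  let s : ℕ → SyzygyModule σ K := fun i => Nat.rec s₀ (fun _ t => next t) i
  have hexact : ∀ i, Function.Exact (d (s (i + 1))) (d (s i)) := fun i =>
    LinearMap.exact_iff.2 ((hker (s i)).trans (hrange (s (i + 1))).symm)
  have hmem : ∀ v, d s₀ v 0 ∈ I := fun v => (hrange s₀).le (LinearMap.mem_range_self _ v)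
  refine ⟨{
    rank := fun i => (s (i + 1)).rank
    deg := fun i => (s (i + 1)).deg
    d := fun i => d (s (i + 1))
    ε := (LinearMap.proj 0 ∘ₗ d s₀).codRestrict I hmem
    d_deg := fun i => hdeg (s (i + 1))
    ε_deg := fun b m hm => ?_
    ε_surjective := fun x => ?_
    exact_zero := fun y => ?_
    exact_succ := fun i => hexact (i + 1)
    minimal := fun i v => hmin (s i) _ ((hker (s i)).le ((hexact i).apply_apply_eq_zero v)) }⟩
  · have hdegree : 0 + m.degree = (next s₀).deg b := hdeg s₀ b 0 m (mem_support_iff.2 hm)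
    rw [zero_add, Finsupp.degree_eq_weight_one] at hdegree
    exact hdegree
  · obtain ⟨v, hv⟩ := (hrange s₀).ge (show (fun _ => (x : MvPolynomial σ K)) ∈ s₀.syz from x.2)
    exact ⟨v, Subtype.ext (congrFun hv 0)⟩
  · rw [← hexact 0 y]
    refine ⟨fun h => funext fun b => ?_, fun h => Subtype.ext (congrFun h 0)⟩
    rw [Subsingleton.elim (α := Fin 1) b 0]
    exact congrArg Subtype.val h

end Existence

/-! ### Pure submodules in exact complexes -/

section Pure

open RingTheory.Sequence

variable {R : Type*} [CommRing R]

section TwoModules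

variable {M N : Type*} [AddCommGroup M] [Module R M] [AddCommGroup N] [Module R N]
  {𝔞 : Ideal R} {x : R}

/-- `P` is pure for the ideal `𝔞` if `P ∩ 𝔞M = 𝔞P`. When `M` is flat, this is the vanishing of
`Tor₁(M ⧸ P, R ⧸ 𝔞)`, stated without `Tor`. -/
def IsIdealPure (𝔞 : Ideal R) (P : Submodule R M) : Prop :=
  P ⊓ 𝔞 • ⊤ ≤ 𝔞 • P

lemma isIdealPure_bot (P : Submodule R M) : IsIdealPure ⊥ P := by
  rw [IsIdealPure, Submodule.bot_smul, Submodule.bot_smul, inf_bot_eq]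

lemma isIdealPure_span_singleton {P : Submodule R M} (hP : ∀ v, x • v ∈ P → v ∈ P) :
    IsIdealPure (Ideal.span {x}) P := by
  rintro _ ⟨hxv, hv⟩
  rw [Submodule.ideal_span_singleton_smul] at hv ⊢
  obtain ⟨v, -, rfl⟩ := hv
  exact Submodule.smul_mem_pointwise_smul _ _ _ (hP v hxv)

lemma mem_sup_span_singleton_smul_top {v : M} :
    v ∈ (𝔞 ⊔ Ideal.span {x}) • (⊤ : Submodule R M) ↔
      ∃ a ∈ 𝔞 • (⊤ : Submodule R M), ∃ f, a + x • f = v := by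
  simp only [Submodule.sup_smul, Submodule.ideal_span_singleton_smul, Submodule.mem_sup,
    Submodule.mem_smul_pointwise_iff_exists, Submodule.mem_top, true_and, exists_exists_eq_and]

lemma IsIdealPure.exists_map_eq {d : M →ₗ[R] N} (h : IsIdealPure 𝔞 (LinearMap.range d)) {f : M}
    (hf : d f ∈ 𝔞 • (⊤ : Submodule R N)) : ∃ a ∈ 𝔞 • (⊤ : Submodule R M), d a = d f := by
  have hdf := h ⟨LinearMap.mem_range_self d f, hf⟩
  rwa [LinearMap.range_eq_map, ← Submodule.map_smul''] at hdf

lemma IsIdealPure.ker_sup_span_singleton {d : M →ₗ[R] N}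
    (hrange : IsIdealPure 𝔞 (LinearMap.range d)) (hker : IsIdealPure 𝔞 (LinearMap.ker d))
    (hx : IsSMulRegular (N ⧸ 𝔞 • (⊤ : Submodule R N)) x) :
    IsIdealPure (𝔞 ⊔ Ideal.span {x}) (LinearMap.ker d) := by
  rintro _ ⟨hv, hv_mem⟩
  obtain ⟨a, ha, f, rfl⟩ := mem_sup_span_singleton_smul_top.1 hv_mem
  have hxf : x • d f = -d a := by
    rw [eq_neg_iff_add_eq_zero, add_comm, ← map_smul, ← map_add]
    exact hv
  have hda : d a ∈ 𝔞 • (⊤ : Submodule R N) := Submodule.smul_top_le_comap_smul_top 𝔞 d ha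
  have hdf : d f ∈ 𝔞 • (⊤ : Submodule R N) :=
    (isSMulRegular_quotient_iff_mem_of_smul_mem _ _).1 hx _ (hxf ▸ Submodule.neg_mem _ hda)
  obtain ⟨a', ha', hda'⟩ := hrange.exists_map_eq hdf
  have hf_ker : f - a' ∈ LinearMap.ker d := by rw [LinearMap.mem_ker, map_sub, hda', sub_self]
  have ha_ker : a + x • a' ∈ LinearMap.ker d := by
    rw [LinearMap.mem_ker, map_add, map_smul, hda', hxf, add_neg_cancel]
  have ha_mem := hker ⟨ha_ker, Submodule.add_mem _ ha (Submodule.smul_mem _ x ha')⟩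
  rw [Submodule.sup_smul, Submodule.ideal_span_singleton_smul,
    show a + x • f = (a + x • a') + x • (f - a') by rw [smul_sub]; abel]
  exact Submodule.add_mem_sup ha_mem (Submodule.smul_mem_pointwise_smul _ _ _ hf_ker)

/-- The connecting map for multiplication by `x`: an `x`-torsion class in `N ⧸ (range d + 𝔞N)`,
represented by `w`, moves one step up the complex to the class of `v` without changing its
annihilator. -/
lemma IsIdealPure.mem_ker_sup_iff {d : M →ₗ[R] N} (hrange : IsIdealPure 𝔞 (LinearMap.range d))
    (hx : IsSMulRegular (N ⧸ 𝔞 • (⊤ : Submodule R N)) x) {v : M} {w : N}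
    (h : d v - x • w ∈ 𝔞 • (⊤ : Submodule R N)) :
    v ∈ LinearMap.ker d ⊔ (𝔞 ⊔ Ideal.span {x}) • ⊤ ↔ w ∈ LinearMap.range d ⊔ 𝔞 • ⊤ := by
  have hmap : ∀ a ∈ 𝔞 • (⊤ : Submodule R M), d a ∈ 𝔞 • (⊤ : Submodule R N) :=
    Submodule.smul_top_le_comap_smul_top 𝔞 d
  rw [Submodule.mem_sup, Submodule.mem_sup]
  constructor
  · rintro ⟨z, hz, _, hq, rfl⟩
    obtain ⟨a, ha, f, rfl⟩ := mem_sup_span_singleton_smul_top.1 hq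
    rw [map_add, LinearMap.mem_ker.1 hz, zero_add, map_add, map_smul, add_sub_assoc,
      ← smul_sub] at h
    have hxw : x • (d f - w) ∈ 𝔞 • (⊤ : Submodule R N) :=
      (Submodule.add_mem_iff_right _ (hmap a ha)).1 h
    refine ⟨d f, LinearMap.mem_range_self d f, w - d f, ?_, add_sub_cancel _ _⟩
    rw [← neg_sub]
    exact Submodule.neg_mem _ ((isSMulRegular_quotient_iff_mem_of_smul_mem _ _).1 hx _ hxw)
  · rintro ⟨_, ⟨f, rfl⟩, a, ha, rfl⟩
    have hd : d (v - x • f) ∈ 𝔞 • (⊤ : Submodule R N) := by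
      rw [map_sub, map_smul, show d v - x • d f = (d v - x • (d f + a)) + x • a by
        rw [smul_add]; abel]
      exact Submodule.add_mem _ h (Submodule.smul_mem _ x ha)
    obtain ⟨a', ha', hda'⟩ := hrange.exists_map_eq hd
    refine ⟨v - x • f - a', ?_, a' + x • f,
      mem_sup_span_singleton_smul_top.2 ⟨a', ha', f, rfl⟩, by abel⟩
    rw [LinearMap.mem_ker, map_sub, hda', sub_self]

end TwoModules

section Complex

variable {M : ℕ → Type*} [∀ k, AddCommGroup (M k)] [∀ k, Module R (M k)]
  {d : ∀ k, M (k + 1) →ₗ[R] M k} {r : R} {rs : List R}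

lemma isIdealPure_range_ofList (hex : ∀ k, Function.Exact (d (k + 1)) (d k))
    (hreg : ∀ k, IsWeaklyRegular (M k) (r :: rs))
    (hpure : IsIdealPure (Ideal.span {r}) (LinearMap.range (d 0))) {k : ℕ} (hk : rs.length ≤ k) :
    IsIdealPure (Ideal.ofList (r :: rs)) (LinearMap.range (d k)) := by
  have hker : ∀ k, LinearMap.ker (d k) = LinearMap.range (d (k + 1)) := fun k =>
    (hex k).linearMap_ker_eq
  induction rs using List.reverseRecOn generalizing k with
  | nil =>
    rw [Ideal.ofList_singleton]
    cases k with
    | zero => exact hpure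
    | succ k =>
      have hr := (isWeaklyRegular_singleton_iff _ _).1
        ((isWeaklyRegular_append_iff _ [] [r]).1 (hreg k)).2
      rw [Ideal.ofList_nil] at hr
      rw [← hker, ← bot_sup_eq (Ideal.span {r})]
      exact (isIdealPure_bot _).ker_sup_span_singleton (isIdealPure_bot _) hr
  | append_singleton rs x ih =>
    rw [List.length_append, List.length_singleton] at hk
    obtain ⟨k, rfl⟩ := Nat.exists_eq_succ_of_ne_zero (Nat.ne_zero_of_lt hk)
    have hk' : rs.length ≤ k := Nat.le_of_succ_le_succ hk
    have hreg' := fun k => (isWeaklyRegular_append_iff _ (r :: rs) [x]).1 (hreg k)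
    rw [← List.cons_append, Ideal.ofList_append, Ideal.ofList_singleton, ← hker]
    refine (ih (fun k => (hreg' k).1) hk').ker_sup_span_singleton ?_
      ((isWeaklyRegular_singleton_iff _ _).1 (hreg' k).2)
    rw [hker]
    exact ih (fun k => (hreg' k).1) (hk'.trans k.le_succ)

end Complex

end Pure

/-! ### Socle elements along a graded free resolution -/

section Socle

open RingTheory.Sequence

variable {σ K : Type*} [Field K]

variable (K) in
/-- The ideal of `K[σ]` generated by the variables in `A`. -/
def variableIdeal (A : Set σ) : Ideal (MvPolynomial σ K) :=
  Ideal.span (X '' A)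

lemma mem_variableIdeal {A : Set σ} {f : MvPolynomial σ K} :
    f ∈ variableIdeal K A ↔ ∀ m ∈ f.support, ∃ i ∈ A, m i ≠ 0 :=
  mem_ideal_span_X_image

lemma X_mem_variableIdeal {A : Set σ} {i : σ} (hi : i ∈ A) : X i ∈ variableIdeal K A :=
  Ideal.subset_span (Set.mem_image_of_mem X hi)

lemma ofList_map_X (l : List σ) : Ideal.ofList (l.map X) = variableIdeal K {i | i ∈ l} :=
  congrArg Ideal.span (by ext; simp)

lemma mem_variableIdeal_of_X_mul_mem {A : Set σ} {i : σ} (hi : i ∉ A) {f : MvPolynomial σ K}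
    (hf : X i * f ∈ variableIdeal K A) : f ∈ variableIdeal K A := by
  rw [mem_variableIdeal] at hf ⊢
  intro m hm
  obtain ⟨a, ha, hne⟩ := hf (Finsupp.single i 1 + m) (by
    rwa [mem_support_iff, coeff_X_mul, ← mem_support_iff])
  refine ⟨a, ha, ?_⟩
  rwa [Finsupp.add_apply, Finsupp.single_eq_of_ne (ne_of_mem_of_not_mem ha hi), zero_add] at hne

section FreeModule

variable {ι : Type*} [Finite ι]

lemma mem_ideal_smul_top_pi_iff {R : Type*} [CommRing R] {𝔞 : Ideal R} {v : ι → R} :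
    v ∈ 𝔞 • (⊤ : Submodule R (ι → R)) ↔ ∀ b, v b ∈ 𝔞 := by
  classical
  cases nonempty_fintype ι
  refine ⟨fun hv b => ?_, fun hv => ?_⟩
  · simpa using Submodule.smul_top_le_comap_smul_top 𝔞 (LinearMap.proj b) hv
  · rw [pi_eq_sum_univ' v]
    exact Submodule.sum_mem _ fun b _ => Submodule.smul_mem_smul (hv b) Submodule.mem_top

lemma isWeaklyRegular_map_X {l : List σ} (hl : l.Nodup) :
    IsWeaklyRegular (ι → MvPolynomial σ K) (l.map (X : σ → MvPolynomial σ K)) := by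
  induction l using List.reverseRecOn with
  | nil => exact IsWeaklyRegular.nil _ _
  | append_singleton l i ih =>
    obtain ⟨hl, -, hdisjoint⟩ := List.nodup_append.1 hl
    have hi : i ∉ {j | j ∈ l} := fun hi => hdisjoint i hi i (List.mem_singleton_self i) rfl
    rw [List.map_append, List.map_singleton, isWeaklyRegular_append_iff,
      isWeaklyRegular_singleton_iff, ofList_map_X]
    refine ⟨ih hl, (isSMulRegular_quotient_iff_mem_of_smul_mem _ _).2 fun v hv => ?_⟩
    rw [mem_ideal_smul_top_pi_iff] at hv ⊢
    exact fun b => mem_variableIdeal_of_X_mul_mem hi (hv b)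

lemma freeComponent_mem_variableIdeal_smul_top {A : Set σ} {v : ι → MvPolynomial σ K}
    (hv : v ∈ variableIdeal K A • (⊤ : Submodule (MvPolynomial σ K) (ι → MvPolynomial σ K)))
    (deg : ι → ℕ) (j : ℕ) : freeComponent deg j v ∈
      variableIdeal K A • (⊤ : Submodule (MvPolynomial σ K) (ι → MvPolynomial σ K)) := by
  simp only [mem_ideal_smul_top_pi_iff, mem_variableIdeal] at hv ⊢
  intro b m hm
  rw [mem_support_iff, coeff_freeComponent, ite_ne_right_iff] at hm
  exact hv b m (mem_support_iff.2 hm.2)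

lemma IsFreeHomogeneous.exists_deg_eq {deg : ι → ℕ} {n : ℕ} {w : ι → MvPolynomial σ K}
    (hw : IsFreeHomogeneous deg n w)
    (hmem : w ∉ variableIdeal K (Set.univ : Set σ) •
      (⊤ : Submodule (MvPolynomial σ K) (ι → MvPolynomial σ K))) :
    ∃ b, deg b = n := by
  simp only [mem_ideal_smul_top_pi_iff, mem_variableIdeal, not_forall, Set.mem_univ, true_and,
    not_exists, not_not] at hmem
  obtain ⟨b, m, hm, hm_zero⟩ := hmem
  have hdeg := hw b m hm
  rw [show m = 0 from Finsupp.ext hm_zero, map_zero, add_zero] at hdeg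
  exact ⟨b, hdeg⟩

lemma IsFreeHomogeneous.exists_homogeneous_lift {κ : Type*} [Finite κ] [DecidableEq κ]
    {deg : ι → ℕ} {deg' : κ → ℕ}
    {d : (κ → MvPolynomial σ K) →ₗ[MvPolynomial σ K] (ι → MvPolynomial σ K)}
    (hd : ∀ b, IsFreeHomogeneous deg (deg' b) (d (Pi.single b 1))) {A : Set σ} {n : ℕ}
    {w : ι → MvPolynomial σ K} (hw : IsFreeHomogeneous deg n w)
    (hmem : w ∈ LinearMap.range d ⊔ variableIdeal K A • ⊤) :
    ∃ v, IsFreeHomogeneous deg' n v ∧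
      d v - w ∈ variableIdeal K A • (⊤ : Submodule (MvPolynomial σ K) (ι → MvPolynomial σ K)) := by
  obtain ⟨_, ⟨v, rfl⟩, a, ha, hva⟩ := Submodule.mem_sup.1 hmem
  refine ⟨freeComponent deg' n v, isFreeHomogeneous_freeComponent _ _ _, ?_⟩
  rw [← freeComponent_map hd, ← hw.freeComponent_self, ← map_sub, ← hva, sub_add_cancel_left,
    map_neg]
  exact Submodule.neg_mem _ (freeComponent_mem_variableIdeal_smul_top ha _ _)

end FreeModule

/-- The connecting maps for the variables in `l`, composed: `w` represents the image of the class
of `u`, and the two classes have the same annihilator. -/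
theorem exists_isFreeHomogeneous_smul_mem_iff {ι : ℕ → Type*} [∀ k, Finite (ι k)]
    [∀ k, DecidableEq (ι k)] {deg : ∀ k, ι k → ℕ}
    {d : ∀ k, (ι (k + 1) → MvPolynomial σ K) →ₗ[MvPolynomial σ K] (ι k → MvPolynomial σ K)}
    (hex : ∀ k, Function.Exact (d (k + 1)) (d k))
    (hdeg : ∀ k b, IsFreeHomogeneous (deg k) (deg (k + 1) b) (d k (Pi.single b 1))) {e : σ}
    (he : ∀ v, (X e : MvPolynomial σ K) • v ∈ LinearMap.range (d 0) → v ∈ LinearMap.range (d 0))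
    {n : ℕ} {u : ι 0 → MvPolynomial σ K} (hu : IsFreeHomogeneous (deg 0) n u) {l : List σ}
    (hl : (e :: l).Nodup)
    (hsocle : ∀ i ∈ l, (X i : MvPolynomial σ K) • u ∈
      LinearMap.range (d 0) ⊔ variableIdeal K {i | i ∈ [e]} • ⊤) :
    ∃ w, IsFreeHomogeneous (deg l.length) (n + l.length) w ∧ ∀ f : MvPolynomial σ K,
      f • w ∈ LinearMap.range (d l.length) ⊔ variableIdeal K {i | i ∈ e :: l} • ⊤ ↔
        f • u ∈ LinearMap.range (d 0) ⊔ variableIdeal K {i | i ∈ [e]} • ⊤ := by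
  induction l using List.reverseRecOn with
  | nil => exact ⟨u, hu, fun f => Iff.rfl⟩
  | append_singleton l i ih =>
    rw [← List.cons_append] at hl ⊢
    have hl' : (e :: l).Nodup := (List.nodup_append.1 hl).1
    obtain ⟨w, hw, hwu⟩ := ih hl' fun j hj => hsocle j (List.mem_append_left _ hj)
    obtain ⟨v, hv, hdv⟩ := (hw.monomial_smul (Finsupp.single i 1) 1).exists_homogeneous_lift
      (hdeg l.length) ((hwu (X i)).2 (hsocle i (by simp)))
    have hpure := isIdealPure_range_ofList hex (fun k => isWeaklyRegular_map_X hl')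
      (isIdealPure_span_singleton he) (List.length_map (as := l) X).le
    have hreg := (isWeaklyRegular_singleton_iff _ _).1 ((isWeaklyRegular_append_iff _ _ [X i]).1
      (List.map_append ▸ isWeaklyRegular_map_X (ι := ι l.length) (K := K) hl)).2
    rw [← List.map_cons, ofList_map_X] at hpure
    rw [ofList_map_X] at hreg
    have hideal : variableIdeal K {j | j ∈ e :: l ++ [i]} =
        variableIdeal K {j | j ∈ e :: l} ⊔ Ideal.span {X i} := by
      rw [← ofList_map_X, ← ofList_map_X, List.map_append, Ideal.ofList_append,
        List.map_singleton, Ideal.ofList_singleton]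
    rw [Finsupp.degree_single, add_assoc] at hv
    rw [List.length_append, List.length_singleton, hideal]
    refine ⟨v, hv, fun f => ?_⟩
    have hdfv : d l.length (f • v) - (X i : MvPolynomial σ K) • f • w ∈
        variableIdeal K {j | j ∈ e :: l} •
          (⊤ : Submodule (MvPolynomial σ K) (ι l.length → MvPolynomial σ K)) := by
      rw [map_smul, smul_comm, ← smul_sub]
      exact Submodule.smul_mem _ f hdv
    rw [← hwu f, ← hpure.mem_ker_sup_iff hreg hdfv, (hex _).linearMap_ker_eq]

end Socle

/-! ### A lower bound for the regularity -/

section Regularity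

variable {σ K : Type*} [Field K]

namespace MinimalGradedFreeResolution

variable {I : Ideal (MvPolynomial σ K)}
  (F : MinimalGradedFreeResolution (σ := σ) (K := K) (idealGrading I))

/-- The ranks of the augmented resolution `⋯ → F₁ → F₀ → K[σ]`, whose cokernel is `K[σ] ⧸ I`. -/
def augRank : ℕ → ℕ
  | 0 => 1
  | k + 1 => F.rank k

/-- The degrees of the basis elements of the augmented resolution `⋯ → F₁ → F₀ → K[σ]`. -/
def augDeg : ∀ k, Fin (F.augRank k) → ℕ
  | 0 => fun _ => 0
  | k + 1 => F.deg k

/-- The differentials of the augmented resolution `⋯ → F₁ → F₀ → K[σ]`. -/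
def augD : ∀ k, (Fin (F.augRank (k + 1)) → MvPolynomial σ K) →ₗ[MvPolynomial σ K]
    (Fin (F.augRank k) → MvPolynomial σ K)
  | 0 => LinearMap.pi fun _ => I.subtype ∘ₗ F.ε
  | k + 1 => F.d k

lemma augD_exact : ∀ k, Function.Exact (F.augD (k + 1)) (F.augD k)
  | 0 => fun v => Iff.trans
    ⟨fun h => Subtype.ext (congrFun h (0 : Fin 1)), fun h => funext fun _ => congrArg Subtype.val h⟩
    (F.exact_zero v)
  | k + 1 => F.exact_succ k

lemma isFreeHomogeneous_augD : ∀ k b,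
    IsFreeHomogeneous (F.augDeg k) (F.augDeg (k + 1) b) (F.augD k (Pi.single b 1))
  | 0 => fun b => isFreeHomogeneous_zero_iff.2 fun _ => F.ε_deg b
  | k + 1 => F.d_deg k

lemma mem_range_augD_zero {v : Fin (F.augRank 0) → MvPolynomial σ K} :
    v ∈ LinearMap.range (F.augD 0) ↔ v (0 : Fin 1) ∈ I := by
  refine ⟨?_, fun hv => ?_⟩
  · rintro ⟨w, rfl⟩
    exact (F.ε w).2
  · obtain ⟨w, hw⟩ := F.ε_surjective ⟨v (0 : Fin 1), hv⟩
    refine ⟨w, funext fun b => ?_⟩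
    rw [Subsingleton.elim (α := Fin 1) b 0]
    exact congrArg Subtype.val hw

lemma const_mem_range_augD_zero_sup {f : MvPolynomial σ K} {𝔞 : Ideal (MvPolynomial σ K)} :
    (fun _ => f) ∈ LinearMap.range (F.augD 0) ⊔ 𝔞 • ⊤ ↔ f ∈ I ⊔ 𝔞 := by
  rw [Submodule.mem_sup, Submodule.mem_sup]
  constructor
  · rintro ⟨v, hv, a, ha, h⟩
    exact ⟨_, F.mem_range_augD_zero.1 hv, _, mem_ideal_smul_top_pi_iff.1 ha _,
      congrFun h (0 : Fin 1)⟩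
  · rintro ⟨g, hg, a, ha, rfl⟩
    exact ⟨fun _ => g, F.mem_range_augD_zero.2 hg, fun _ => a,
      mem_ideal_smul_top_pi_iff.2 fun _ => ha, rfl⟩

end MinimalGradedFreeResolution

theorem exists_deg_eq_of_socle [Finite σ] {I : Ideal (MvPolynomial σ K)}
    (F : MinimalGradedFreeResolution (σ := σ) (K := K) (idealGrading I)) {e : σ}
    (he : ∀ f, X e * f ∈ I → f ∈ I) {n : ℕ} {u : MvPolynomial σ K} (hu : u.IsHomogeneous n)
    (hu_notMem : u ∉ I ⊔ variableIdeal K {e})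
    (hu_socle : ∀ i, X i * u ∈ I ⊔ variableIdeal K {e}) {k : ℕ} (hk : Nat.card σ = k + 2) :
    ∃ b, F.deg k b = n + (k + 1) := by
  classical
  cases nonempty_fintype σ
  obtain ⟨l, hl, hl_univ, hlength⟩ : ∃ l : List σ,
      (e :: l).Nodup ∧ (∀ i, i ∈ e :: l) ∧ l.length = k + 1 := by
    refine ⟨(Finset.univ.erase e).toList, by simp [Finset.nodup_toList], fun i => by
      simp [or_iff_not_imp_left], ?_⟩
    rw [Finset.length_toList, Finset.card_erase_of_mem (Finset.mem_univ e), Finset.card_univ,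
      ← Nat.card_eq_fintype_card, hk]
    rfl
  have hsingle : {i | i ∈ [e]} = {e} := by simp
  have he' : ∀ v, (X e : MvPolynomial σ K) • v ∈ LinearMap.range (F.augD 0) →
      v ∈ LinearMap.range (F.augD 0) := fun v hv =>
    F.mem_range_augD_zero.2 (he _ (F.mem_range_augD_zero.1 hv))
  obtain ⟨w, hw, hwu⟩ := exists_isFreeHomogeneous_smul_mem_iff (deg := F.augDeg) F.augD_exact
    F.isFreeHomogeneous_augD he' (u := fun _ => u)
    (isFreeHomogeneous_zero_iff.2 fun _ => hu) hl fun i _ => by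
      rw [hsingle]
      exact F.const_mem_range_augD_zero_sup.2 (hu_socle i)
  have hw_notMem : w ∉ variableIdeal K (Set.univ : Set σ) •
      (⊤ : Submodule (MvPolynomial σ K) (Fin (F.augRank l.length) → MvPolynomial σ K)) := by
    intro hmem
    refine hu_notMem (F.const_mem_range_augD_zero_sup.1 ?_)
    rw [← Set.eq_univ_of_forall hl_univ] at hmem
    have := (hwu 1).1 (by rw [one_smul]; exact Submodule.mem_sup_right hmem)
    rwa [one_smul, hsingle] at this
  have hdeg := hw.exists_deg_eq hw_notMem
  rw [hlength] at hdeg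
  exact hdeg

lemma le_regularity {M : Type*} [AddCommGroup M] [Module (MvPolynomial σ K) M]
    {ℳ : ℕ → AddSubgroup M} (hne : Nonempty (MinimalGradedFreeResolution (σ := σ) (K := K) ℳ))
    {n : ℕ} (h : ∀ F : MinimalGradedFreeResolution (σ := σ) (K := K) ℳ,
      ∃ k b, n + k ≤ F.deg k b) : (n : EReal) ≤ regularity σ K ℳ := by
  obtain ⟨k, b, hb⟩ := h (Classical.choice hne)
  have hbetti : gradedBetti σ K ℳ k ((Classical.choice hne).deg k b) ≠ 0 := by
    rw [gradedBetti, dif_pos hne, MinimalGradedFreeResolution.betti]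
    exact Nat.card_ne_zero.2 ⟨⟨b, rfl⟩, inferInstance⟩
  refine le_trans ?_ (le_iSup_of_le k (le_iSup₂_of_le _ hbetti le_rfl))
  have hreal : (n : ℝ) ≤ (Classical.choice hne).deg k b - k := by
    rw [le_sub_iff_add_le]
    exact_mod_cast hb
  exact_mod_cast EReal.coe_le_coe_iff.2 hreal

lemma exists_deg_zero_ne_zero {I : Ideal (MvPolynomial σ K)} (hI : I ≠ ⊥) (hI' : I ≠ ⊤)
    (F : MinimalGradedFreeResolution (σ := σ) (K := K) (idealGrading I)) :
    ∃ b, F.deg 0 b ≠ 0 := by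
  by_contra! hdeg
  have hsingle : ∀ b, F.ε (Pi.single b 1) = 0 := fun b => by
    by_contra hne
    have hε_deg := F.ε_deg b
    rw [hdeg b] at hε_deg
    replace hε_deg : (F.ε (Pi.single b 1) : MvPolynomial σ K).IsHomogeneous 0 := hε_deg
    rw [← totalDegree_zero_iff_isHomogeneous, totalDegree_eq_zero_iff_eq_C] at hε_deg
    refine hI' (Ideal.eq_top_of_isUnit_mem I (F.ε (Pi.single b 1)).2 ?_)
    rw [hε_deg]
    refine (IsUnit.mk0 _ fun h0 => hne (Subtype.ext ?_)).map C
    rw [hε_deg, h0, C_0, Submodule.coe_zero]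
  have hε : F.ε = 0 := LinearMap.pi_ext' fun b => LinearMap.ext_ring (hsingle b)
  refine hI ((Submodule.eq_bot_iff I).2 fun x hx => ?_)
  obtain ⟨v, hv⟩ := F.ε_surjective ⟨x, hx⟩
  rw [hε] at hv
  exact (congrArg Subtype.val hv).symm

variable [Finite σ] {I : Ideal (MvPolynomial σ K)}

theorem one_le_idealRegularity (hI : ∀ f ∈ I, ∀ j, homogeneousComponent j f ∈ I)
    (hI_top : I ≠ ⊤) : 1 ≤ idealRegularity I := by
  rw [idealRegularity]
  split_ifs with hI_bot
  · exact le_rfl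
  · refine mod_cast le_regularity (n := 1) (nonempty_minimalGradedFreeResolution hI) fun F => ?_
    obtain ⟨b, hb⟩ := exists_deg_zero_ne_zero hI_bot hI_top F
    exact ⟨0, b, Nat.one_le_iff_ne_zero.2 hb⟩

theorem succ_le_idealRegularity_of_socle (hI : ∀ f ∈ I, ∀ j, homogeneousComponent j f ∈ I) {e : σ}
    (he : ∀ f, X e * f ∈ I → f ∈ I) {n : ℕ} {u : MvPolynomial σ K} (hu : u.IsHomogeneous n)
    (hu_notMem : u ∉ I ⊔ variableIdeal K {e})
    (hu_socle : ∀ i, X i * u ∈ I ⊔ variableIdeal K {e}) :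
    ((n + 1 : ℕ) : EReal) ≤ idealRegularity I := by
  obtain rfl | hn := eq_or_ne n 0
  · rw [zero_add, Nat.cast_one]
    exact one_le_idealRegularity hI fun h => hu_notMem (by simp [h])
  obtain ⟨i, hi⟩ : ∃ i, i ≠ e := by
    by_contra! hsub
    refine hu_notMem (Submodule.mem_sup_right (mem_variableIdeal.2 fun m hm => ⟨e, rfl, ?_⟩))
    intro hme
    refine hn ((hu (mem_support_iff.1 hm)).symm.trans ?_)
    rw [show m = 0 from Finsupp.ext fun i => hsub i ▸ hme, map_zero]
  have hI_bot : I ≠ ⊥ := by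
    rintro rfl
    rw [bot_sup_eq] at hu_notMem hu_socle
    exact hu_notMem (mem_variableIdeal_of_X_mul_mem (Set.notMem_singleton_iff.2 hi) (hu_socle i))
  rw [idealRegularity, if_neg hI_bot]
  refine le_regularity (nonempty_minimalGradedFreeResolution hI) fun F => ?_
  obtain ⟨k, hk⟩ := Nat.exists_eq_add_of_le' (Finite.one_lt_card_iff_nontrivial.2 ⟨i, e, hi⟩)
  obtain ⟨b, hb⟩ := exists_deg_eq_of_socle F he hu hu_notMem hu_socle hk
  exact ⟨k, b, by omega⟩

end Regularity

/-! ### Even sets of edges and joins -/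

section Joins

variable {V : Type*}

/-- The column of an edge in the incidence matrix over the field with two elements, with entry `1`
at both ends of the edge. -/
def edgeVector : Sym2 V → V →₀ ZMod 2 :=
  Sym2.lift ⟨fun i j => Finsupp.single i 1 + Finsupp.single j 1, fun _ _ => add_comm _ _⟩

/-- A set of edges is even if every vertex has even degree in it, which is expressed by the
vanishing of the sum of its incidence vectors. -/
def IsEvenSet (C : Finset (Sym2 V)) : Prop :=
  ∑ f ∈ C, edgeVector f = 0

lemma edgeVector_mk (i j : V) :
    edgeVector s(i, j) = Finsupp.single i 1 + Finsupp.single j 1 := rfl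

lemma isEvenSet_symmDiff_iff [DecidableEq V] {A B : Finset (Sym2 V)} :
    IsEvenSet (symmDiff A B) ↔ ∑ f ∈ A, edgeVector f = ∑ f ∈ B, edgeVector f := by
  rw [IsEvenSet, symmDiff_def, Finset.sup_eq_union, Finset.sum_union disjoint_sdiff_sdiff,
    ← ZModModule.sub_eq_add, sub_eq_zero, ← Finset.sum_inter_add_sum_sdiff A B,
    ← Finset.sum_inter_add_sum_sdiff B A, Finset.inter_comm B A, add_right_inj]

lemma IsEvenSet.sdiff [DecidableEq V] {C T : Finset (Sym2 V)} (hC : IsEvenSet C)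
    (hT : IsEvenSet T) (hTC : T ⊆ C) : IsEvenSet (C \ T) := by
  rwa [IsEvenSet, ← Finset.sum_sdiff hTC, hT, add_zero] at hC

lemma sum_edgeVector_edges {G : SimpleGraph V} {u v : V} (p : G.Walk u v) :
    (p.edges.map edgeVector).sum = Finsupp.single u 1 + Finsupp.single v 1 := by
  induction p with
  | nil => rw [SimpleGraph.Walk.edges_nil, List.map_nil, List.sum_nil, ZModModule.add_self]
  | @cons u w v h p ih =>
    rw [SimpleGraph.Walk.edges_cons, List.map_cons, List.sum_cons, ih, edgeVector_mk, add_assoc,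
      ← add_assoc (Finsupp.single w 1), ZModModule.add_self, zero_add]

lemma isEvenSet_edges_toFinset [DecidableEq V] {G : SimpleGraph V} {v : V} {c : G.Walk v v}
    (hc : c.IsTrail) : IsEvenSet c.edges.toFinset := by
  rw [IsEvenSet, List.sum_toFinset _ hc.edges_nodup, sum_edgeVector_edges, ZModModule.add_self]

open SimpleGraph in
/-- A nonempty even set is not a forest: the indicator function of one side of a bridge `f` takes
the value `1` on the incidence vector of `f` and vanishes on those of the other edges. -/
lemma IsEvenSet.not_isAcyclic_fromEdgeSet {G : SimpleGraph V} {C : Finset (Sym2 V)}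
    (hC : IsEvenSet C) (hCG : (C : Set (Sym2 V)) ⊆ G.edgeSet) (hC_nonempty : C.Nonempty) :
    ¬ (fromEdgeSet (C : Set (Sym2 V))).IsAcyclic := by
  classical
  intro hacyclic
  obtain ⟨f, hf⟩ := hC_nonempty
  induction f with | _ x y
  have hadj : ∀ {i j}, s(i, j) ∈ C → (fromEdgeSet (C : Set (Sym2 V))).Adj i j := fun hij =>
    (fromEdgeSet_adj _).2 ⟨hij, ((mem_edgeSet G).1 (hCG hij)).ne⟩
  have hbridge := isBridge_iff.1 (isAcyclic_iff_forall_adj_isBridge.1 hacyclic (hadj hf))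
  set H := (fromEdgeSet (C : Set (Sym2 V))).deleteEdges {s(x, y)}
  let side : (V →₀ ZMod 2) →+ ZMod 2 :=
    Finsupp.liftAddHom fun v => if H.Reachable x v then .id _ else 0
  have hside_edge : ∀ i j, side (edgeVector s(i, j)) =
      (if H.Reachable x i then 1 else 0) + (if H.Reachable x j then 1 else 0) := fun i j => by
    rw [edgeVector_mk, map_add, Finsupp.liftAddHom_apply_single, Finsupp.liftAddHom_apply_single]
    split_ifs <;> rfl
  have hside_other : ∀ g ∈ C, g ≠ s(x, y) → side (edgeVector g) = 0 := by
    intro g hg hne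
    induction g with | _ i j
    have hij : H.Reachable i j := (deleteEdges_adj.2 ⟨hadj hg, hne⟩).reachable
    have hiff : H.Reachable x i ↔ H.Reachable x j :=
      ⟨fun h => h.trans hij, fun h => h.trans hij.symm⟩
    rw [hside_edge, if_congr hiff rfl rfl, ZModModule.add_self]
  have hside_sum := congrArg side hC
  rw [map_sum, Finset.sum_eq_single_of_mem _ hf hside_other, hside_edge, if_pos (.refl x),
    if_neg hbridge, add_zero, map_zero] at hside_sum
  exact one_ne_zero hside_sum

lemma IsEvenSet.exists_isCycle {G : SimpleGraph V} {C : Finset (Sym2 V)} (hC : IsEvenSet C)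
    (hCG : (C : Set (Sym2 V)) ⊆ G.edgeSet) (hC_nonempty : C.Nonempty) :
    ∃ (v : V) (c : G.Walk v v), c.IsCycle ∧ ∀ f ∈ c.edges, f ∈ C := by
  have hle : SimpleGraph.fromEdgeSet (C : Set (Sym2 V)) ≤ G := by
    rw [← G.fromEdgeSet_edgeSet]
    exact SimpleGraph.fromEdgeSet_mono hCG
  have hcycle := hC.not_isAcyclic_fromEdgeSet hCG hC_nonempty
  simp only [SimpleGraph.IsAcyclic, not_forall, not_not] at hcycle
  obtain ⟨v, c, hc⟩ := hcycle
  refine ⟨v, c.mapLe hle, hc.mapLe hle, fun f hf => ?_⟩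
  rw [SimpleGraph.Walk.edges_mapLe_eq_edges] at hf
  have hfC := c.edges_subset_edgeSet hf
  rw [SimpleGraph.edgeSet_fromEdgeSet] at hfC
  exact hfC.1

variable {G : SimpleGraph V} {J : Finset (Sym2 V)}

lemma IsJoin.two_mul_card_inter_le [DecidableEq V] (hJ : IsJoin G J) {C : Finset (Sym2 V)}
    (hC : IsEvenSet C) (hCG : (C : Set (Sym2 V)) ⊆ G.edgeSet) : 2 * (J ∩ C).card ≤ C.card := by
  induction C using Finset.strongInduction with
  | H C ih =>
  obtain rfl | hC_nonempty := C.eq_empty_or_nonempty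
  · simp
  obtain ⟨v, c, hc, hcC⟩ := hC.exists_isCycle hCG hC_nonempty
  set T := c.edges.toFinset with hT
  have hTC : T ⊆ C := fun f hf => hcC f (List.mem_toFinset.1 hf)
  have hT_card : T.card = c.length := by
    rw [hT, List.toFinset_card_of_nodup hc.edges_nodup, SimpleGraph.Walk.length_edges]
  have hT_nonempty : T.Nonempty := by
    rw [← Finset.card_pos, hT_card]
    exact Nat.zero_lt_of_lt hc.three_le_length
  have hJT : 2 * (J ∩ T).card ≤ T.card := by
    rw [hT_card]
    convert hJ.2 v c hc
  have hJ_sdiff := ih (C \ T) (Finset.sdiff_ssubset hTC hT_nonempty)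
    (hC.sdiff (isEvenSet_edges_toFinset hc.isTrail) hTC)
    ((Finset.coe_subset.2 Finset.sdiff_subset).trans hCG)
  have hJC : (J ∩ C).card = (J ∩ T).card + (J ∩ (C \ T)).card := by
    rw [← Finset.card_union_of_disjoint (Finset.disjoint_sdiff.mono Finset.inter_subset_right
      Finset.inter_subset_right), ← Finset.inter_union_distrib_left,
      Finset.union_sdiff_of_subset hTC]
  have hC_card := Finset.card_sdiff_add_card_eq_card hTC
  omega

lemma IsJoin.card_erase_add_le [DecidableEq V] (hJ : IsJoin G J) {e : Sym2 V} (he : e ∈ J)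
    {B : Finset (Sym2 V)} (hB : (B : Set (Sym2 V)) ⊆ G.edgeSet)
    (hsum : ∑ f ∈ B, edgeVector f = ∑ f ∈ J.erase e, edgeVector f) :
    (J.erase e).card + (if e ∈ B then 2 else 0) ≤ B.card := by
  have hJ_inter := hJ.two_mul_card_inter_le (isEvenSet_symmDiff_iff.2 hsum) fun f hf => by
    rcases Finset.mem_symmDiff.1 hf with h | h
    · exact hB h.1
    · exact hJ.1 (Finset.mem_of_mem_erase h.1)
  have hsymmDiff : (symmDiff B (J.erase e)).card = (B \ J.erase e).card + (J.erase e \ B).card := by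
    rw [symmDiff_def, Finset.sup_eq_union, Finset.card_union_of_disjoint disjoint_sdiff_sdiff]
  have hinter : (J.erase e \ B).card + (if e ∈ B then 1 else 0) ≤
      (J ∩ symmDiff B (J.erase e)).card := by
    have hsub : J.erase e \ B ⊆ J ∩ symmDiff B (J.erase e) := fun f hf => by
      grind [Finset.mem_symmDiff]
    split_ifs with heB
    · rw [← Finset.card_insert_of_notMem (fun h => (Finset.mem_sdiff.1 h).2 heB)]
      refine Finset.card_le_card (Finset.insert_subset ?_ hsub)
      exact Finset.mem_inter.2 ⟨he, Finset.mem_symmDiff.2 (.inl ⟨heB, Finset.notMem_erase _ _⟩)⟩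
    · exact Finset.card_le_card hsub
  have hB_card := Finset.card_sdiff_add_card_inter B (J.erase e)
  have hJe_card := Finset.card_sdiff_add_card_inter (J.erase e) B
  rw [Finset.inter_comm] at hJe_card
  split_ifs at hinter ⊢ <;> omega

lemma exists_isJoin_card_eq_maxJoinNumber (G : SimpleGraph V) [Finite G.edgeSet] :
    ∃ J : Finset (Sym2 V), IsJoin G J ∧ J.card = maxJoinNumber G := by
  refine Nat.sSup_mem (s := {k | ∃ J : Finset (Sym2 V), IsJoin G J ∧ J.card = k})
    ⟨0, ∅, ⟨by simp, by simp⟩, rfl⟩ ⟨G.edgeSet.ncard, ?_⟩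
  rintro _ ⟨J, hJ, rfl⟩
  rw [← Set.ncard_coe_finset]
  exact Set.ncard_le_ncard hJ.1

end Joins

/-! ### Monomial maps to group algebras -/

section Toric

variable {σ Γ R : Type*}

section CommMonoid

variable [CommSemiring R] [AddCommMonoid Γ]

variable (R) in
/-- The homomorphism from a polynomial ring to the algebra of the monoid `Γ` that sends the
variable `X i` to the element `g i` of `Γ`. Its kernel is the toric ideal of `g`. -/
def toricMap (g : σ → Γ) : MvPolynomial σ R →ₐ[R] AddMonoidAlgebra R Γ :=
  aeval fun i => AddMonoidAlgebra.single (g i) 1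

lemma toricMap_X (g : σ → Γ) (i : σ) : toricMap R g (X i) = AddMonoidAlgebra.single (g i) 1 :=
  aeval_X _ _

lemma toricMap_monomial (g : σ → Γ) (a : σ →₀ ℕ) (r : R) :
    toricMap R g (monomial a r) = AddMonoidAlgebra.single (Finsupp.linearCombination ℕ g a) r := by
  induction a using Finsupp.induction with
  | zero =>
    rw [map_zero, ← C_apply, ← algebraMap_eq, AlgHom.commutes]
    rfl
  | single_add i k a _ _ ih =>
    rw [← one_mul r, ← monomial_mul, ← X_pow_eq_monomial, map_mul, map_pow, ih, toricMap_X,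
      AddMonoidAlgebra.single_pow, AddMonoidAlgebra.single_mul_single, one_pow, map_add,
      Finsupp.linearCombination_single]

lemma exists_mem_support_of_coeff_toricMap_ne_zero {g : σ → Γ} {f : MvPolynomial σ R} {γ : Γ}
    (h : (toricMap R g f).coeff γ ≠ 0) :
    ∃ a ∈ f.support, Finsupp.linearCombination ℕ g a = γ := by
  contrapose! h
  rw [f.as_sum, map_sum, AddMonoidAlgebra.coeff_sum, Finsupp.finsetSum_apply]
  refine Finset.sum_eq_zero fun a ha => ?_
  rw [toricMap_monomial, AddMonoidAlgebra.coeff_single, Finsupp.single_eq_of_ne' (h a ha)]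

end CommMonoid

lemma toricMap_X_mul_eq_zero_iff [CommSemiring R] [AddCommGroup Γ] {g : σ → Γ} {i : σ}
    {f : MvPolynomial σ R} : toricMap R g (X i * f) = 0 ↔ toricMap R g f = 0 := by
  have hunit : IsUnit (toricMap R g (X i)) := by
    refine IsUnit.of_mul_eq_one (AddMonoidAlgebra.single (-g i) 1) ?_
    rw [toricMap_X, AddMonoidAlgebra.single_mul_single, add_neg_cancel, one_mul,
      AddMonoidAlgebra.one_def]
  rw [map_mul, hunit.mul_right_eq_zero]

/-- Choosing a monomial in every fibre of the exponent map defines a linear section of `toricMap`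
modulo `I`. -/
lemma mem_of_toricMap_eq_zero [CommRing R] [AddCommMonoid Γ] {g : σ → Γ}
    {I : Ideal (MvPolynomial σ R)}
    (hI : ∀ a b, Finsupp.linearCombination ℕ g a = Finsupp.linearCombination ℕ g b →
      monomial a 1 - monomial b 1 ∈ I)
    {f : MvPolynomial σ R} (hf : toricMap R g f = 0) : f ∈ I := by
  let lift : Γ → σ →₀ ℕ := Function.invFun (Finsupp.linearCombination ℕ g)
  have hlift : ∀ a, Finsupp.linearCombination ℕ g (lift (Finsupp.linearCombination ℕ g a)) =
      Finsupp.linearCombination ℕ g a := fun a => Function.invFun_eq ⟨a, rfl⟩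
  let s : (Γ →₀ R) →ₗ[R] MvPolynomial σ R ⧸ I :=
    Finsupp.linearCombination R fun γ => Ideal.Quotient.mk I (monomial (lift γ) 1)
  have hs : ∀ f, s (toricMap R g f).coeff = Ideal.Quotient.mk I f := fun f => by
    induction f using MvPolynomial.induction_on' with
    | monomial a r =>
      rw [toricMap_monomial, AddMonoidAlgebra.coeff_single, Finsupp.linearCombination_single,
        Ideal.Quotient.eq.2 (hI _ _ (hlift a)), ← mul_one r, ← smul_eq_mul r 1, ← smul_monomial,
        smul_eq_mul, mul_one]
      rfl
    | add p q hp hq => rw [map_add, AddMonoidAlgebra.coeff_add, map_add, hp, hq, map_add]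
  rw [← Ideal.Quotient.eq_zero_iff_mem, ← hs, hf, AddMonoidAlgebra.coeff_zero, map_zero]

lemma linearCombination_prodMk_const {M N : Type*} [AddCommMonoid M] [AddCommMonoid N] (c : M)
    (h : σ → N) (a : σ →₀ ℕ) :
    Finsupp.linearCombination ℕ (fun i => (c, h i)) a =
      (a.degree • c, Finsupp.linearCombination ℕ h a) := by
  induction a using Finsupp.induction_linear with
  | zero => rw [map_zero, map_zero, map_zero, zero_smul, Prod.mk_zero_zero]
  | add a b ha hb => rw [map_add, ha, hb, map_add, map_add, add_smul, Prod.mk_add_mk]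
  | single i k =>
    rw [Finsupp.linearCombination_single, Finsupp.degree_single, Finsupp.linearCombination_single,
      Prod.smul_mk]

end Toric

/-! ### The graph ideal as a toric ideal -/

section SquareIdeal

variable {V R : Type*} [CommRing R]

/-- The element of `ℤ × 𝔽₂^V` attached to the vertex `i`. Modulo `squareIdeal` a monomial is
determined by its degree and the parities of its exponents, which are recorded by the two
components. -/
def vertexClass (i : V) : ℤ × (V →₀ ZMod 2) :=
  (1, Finsupp.single i 1)

variable (V R) in
/-- The ideal of `R[V]` whose preimage under `theta` is the graph ideal. -/
abbrev squareIdeal : Ideal (MvPolynomial V R) :=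
  Ideal.span {p | ∃ i j : V, p = X i ^ 2 - X j ^ 2}

lemma X_sq_sub_X_sq_mem_squareIdeal (i j : V) : X i ^ 2 - X j ^ 2 ∈ squareIdeal V R :=
  Ideal.subset_span ⟨i, j, rfl⟩

lemma mk_squareIdeal_monomial_two_nsmul (i₀ : V) (a : V →₀ ℕ) :
    Ideal.Quotient.mk (squareIdeal V R) (monomial (2 • a) 1) =
      Ideal.Quotient.mk (squareIdeal V R) (X i₀ ^ 2) ^ a.degree := by
  induction a using Finsupp.induction with
  | zero => simp
  | single_add i k a _ _ ih =>
    rw [nsmul_add, ← one_mul (1 : R), ← monomial_mul, map_mul, ih, map_add, Finsupp.degree_single,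
      pow_add, ← Ideal.Quotient.eq.2 (X_sq_sub_X_sq_mem_squareIdeal i i₀), Finsupp.smul_single,
      ← X_pow_eq_monomial, smul_eq_mul, pow_mul, map_pow]

lemma linearCombination_single_one_apply (a : V →₀ ℕ) (i : V) :
    Finsupp.linearCombination ℕ (fun i => Finsupp.single i (1 : ZMod 2)) a i = a i := by
  induction a using Finsupp.induction_linear with
  | zero => simp
  | add a b ha hb => rw [map_add, Finsupp.add_apply, ha, hb, Finsupp.add_apply, Nat.cast_add]
  | single j k =>
    classical
    rw [Finsupp.linearCombination_single, Finsupp.smul_single, nsmul_one, Finsupp.single_apply,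
      Finsupp.single_apply, apply_ite Nat.cast, Nat.cast_zero]

lemma monomial_sub_monomial_mem_squareIdeal {a b : V →₀ ℕ}
    (h : Finsupp.linearCombination ℕ vertexClass a = Finsupp.linearCombination ℕ vertexClass b) :
    monomial a 1 - monomial b 1 ∈ squareIdeal V R := by
  obtain hV | ⟨⟨i₀⟩⟩ := isEmpty_or_nonempty V
  · rw [Subsingleton.elim a b, sub_self]
    exact zero_mem _
  let half : (V →₀ ℕ) → V →₀ ℕ := Finsupp.mapRange (· / 2) rfl
  let parity : (V →₀ ℕ) → V →₀ ℕ := Finsupp.mapRange (· % 2) rfl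
  have hdecomp : ∀ c, c = 2 • half c + parity c := fun c =>
    Finsupp.ext fun i => (Nat.div_add_mod (c i) 2).symm
  have hdegree_decomp : ∀ c, c.degree = 2 * (half c).degree + (parity c).degree := fun c => by
    rw [← smul_eq_mul, ← map_nsmul, ← map_add, ← hdecomp]
  have hmk : ∀ c, Ideal.Quotient.mk (squareIdeal V R) (monomial c 1) =
      Ideal.Quotient.mk (squareIdeal V R) (X i₀ ^ 2) ^ (half c).degree *
        Ideal.Quotient.mk (squareIdeal V R) (monomial (parity c) 1) := fun c => by
    rw [← mk_squareIdeal_monomial_two_nsmul, ← map_mul, monomial_mul, ← hdecomp, one_mul]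
  obtain ⟨hdegree, hmod⟩ := Prod.ext_iff.1 <| (linearCombination_prodMk_const 1 _ a).symm.trans <|
    h.trans (linearCombination_prodMk_const 1 _ b)
  simp only [nsmul_one, Nat.cast_inj] at hdegree
  have hparity : parity a = parity b := Finsupp.ext fun i => by
    have hi := DFunLike.congr_fun hmod i
    rw [linearCombination_single_one_apply, linearCombination_single_one_apply] at hi
    exact (ZMod.natCast_eq_natCast_iff' _ _ _).1 hi
  have hhalf : (half a).degree = (half b).degree := by
    rw [hdegree_decomp a, hdegree_decomp b, hparity] at hdegree
    omega
  rw [← Ideal.Quotient.eq, hmk a, hmk b, hparity, hhalf]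

lemma mem_squareIdeal_iff {f : MvPolynomial V R} :
    f ∈ squareIdeal V R ↔ toricMap R vertexClass f = 0 := by
  refine ⟨fun hf => ?_, mem_of_toricMap_eq_zero fun _ _ => monomial_sub_monomial_mem_squareIdeal⟩
  suffices hle : squareIdeal V R ≤ RingHom.ker (toricMap R (vertexClass (V := V))) from hle hf
  rw [Ideal.span_le]
  rintro _ ⟨i, j, rfl⟩
  have htwo : ∀ i : V, 2 • vertexClass i = (2, 0) := fun i => by
    rw [vertexClass, Prod.smul_mk, two_nsmul (Finsupp.single i _), ZModModule.add_self, nsmul_one,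
      Nat.cast_two]
  rw [SetLike.mem_coe, RingHom.mem_ker, map_sub, map_pow, map_pow, toricMap_X, toricMap_X,
    AddMonoidAlgebra.single_pow, AddMonoidAlgebra.single_pow, htwo, htwo, sub_self]

lemma homogeneousComponent_mem_squareIdeal {f : MvPolynomial V R} (hf : f ∈ squareIdeal V R)
    (j : ℕ) : homogeneousComponent j f ∈ squareIdeal V R := by
  let _ := gradedAlgebra (σ := V) (R := R)
  refine homogeneousComponent_mem_of_mem (Ideal.homogeneous_span _ _ ?_) hf j
  rintro _ ⟨i, j, rfl⟩
  exact ⟨2, (isHomogeneous_X_pow i 2).sub (isHomogeneous_X_pow j 2)⟩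

end SquareIdeal

lemma homogeneousComponent_aeval {σ τ R : Type*} [CommSemiring R] {d : ℕ} (hd : d ≠ 0)
    {g : σ → MvPolynomial τ R} (hg : ∀ i, (g i).IsHomogeneous d) (j : ℕ) (f : MvPolynomial σ R) :
    homogeneousComponent (d * j) (aeval g f) = aeval g (homogeneousComponent j f) := by
  induction f using MvPolynomial.induction_on' with
  | monomial a r =>
    have hmonomial := isHomogeneous_monomial r (rfl : a.degree = a.degree)
    rw [homogeneousComponent_of_mem hmonomial, homogeneousComponent_of_mem (hmonomial.aeval g hg),
      apply_ite (aeval g), map_zero]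
    exact if_congr (Nat.mul_right_inj hd) rfl rfl
  | add p q hp hq => simp only [map_add, hp, hq]

section GraphIdeal

variable {V K : Type*} [Field K] {G : SimpleGraph V}

/-- The class of the image `X i * X j` under `theta` of the variable of the edge `s(i, j)`. -/
def edgeClass (e : Sym2 V) : ℤ × (V →₀ ZMod 2) :=
  (2, edgeVector e)

lemma toricMap_theta (f : MvPolynomial G.edgeSet K) :
    toricMap K vertexClass (theta K G f) = toricMap K (fun e : G.edgeSet => edgeClass e.1) f := by
  rw [← AlgHom.comp_apply]
  congr 1
  ext1 ⟨e, he⟩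
  induction e with | _ i j
  rw [AlgHom.comp_apply, theta, aeval_X, toricMap_X, Sym2.lift_mk, map_mul, toricMap_X, toricMap_X,
    AddMonoidAlgebra.single_mul_single, one_mul]
  rfl

lemma mem_graphIdeal_iff {f : MvPolynomial G.edgeSet K} :
    f ∈ graphIdeal K G ↔ toricMap K (fun e : G.edgeSet => edgeClass e.1) f = 0 := by
  rw [← toricMap_theta, ← mem_squareIdeal_iff, graphIdeal, Ideal.mem_comap]

lemma mem_graphIdeal_of_X_mul_mem {e : G.edgeSet} {f : MvPolynomial G.edgeSet K}
    (h : X e * f ∈ graphIdeal K G) : f ∈ graphIdeal K G := by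
  rwa [mem_graphIdeal_iff, toricMap_X_mul_eq_zero_iff, ← mem_graphIdeal_iff] at h

lemma homogeneousComponent_mem_graphIdeal {f : MvPolynomial G.edgeSet K}
    (hf : f ∈ graphIdeal K G) (j : ℕ) : homogeneousComponent j f ∈ graphIdeal K G := by
  rw [graphIdeal, Ideal.mem_comap, theta, ← homogeneousComponent_aeval two_ne_zero]
  · exact homogeneousComponent_mem_squareIdeal hf (2 * j)
  · rintro ⟨e, he⟩
    induction e with | _ i j
    exact (isHomogeneous_X K i).mul (isHomogeneous_X K j)

lemma X_sq_sub_X_sq_mem_graphIdeal (e f : G.edgeSet) : X e ^ 2 - X f ^ 2 ∈ graphIdeal K G := by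
  have htwo : ∀ e : Sym2 V, 2 • edgeClass e = (4, 0) := fun e => by
    rw [edgeClass, Prod.smul_mk, two_nsmul (edgeVector e), ZModModule.add_self]
    rfl
  rw [mem_graphIdeal_iff, map_sub, map_pow, map_pow, toricMap_X, toricMap_X,
    AddMonoidAlgebra.single_pow, AddMonoidAlgebra.single_pow, htwo, htwo, sub_self]

lemma graphIdeal_ne_top : graphIdeal K G ≠ ⊤ := by
  rw [Ideal.ne_top_iff_one, mem_graphIdeal_iff, map_one]
  exact one_ne_zero

end GraphIdeal

/-! ### Socle monomials of the graph ideal modulo an edge variable -/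

section Socle

lemma exists_monomial_socle {σ R : Type*} [Finite σ] [CommSemiring R] {Q : Ideal (MvPolynomial σ R)}
    (hsq : ∀ i, X i ^ 2 ∈ Q) {a : σ →₀ ℕ} (ha : monomial a 1 ∉ Q) :
    ∃ b, a ≤ b ∧ monomial b 1 ∉ Q ∧ ∀ i, X i * monomial b 1 ∈ Q := by
  classical
  let S : Set (σ →₀ ℕ) := {b | monomial b 1 ∉ Q}
  have hS : S.Finite := by
    refine (Set.finite_Icc 0 (Finsupp.equivFunOnFinite.symm 1)).subset fun b hb =>
      ⟨zero_le, fun i => ?_⟩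
    by_contra! hi
    refine hb ?_
    rw [← tsub_add_cancel_of_le (Finsupp.single_le_iff.2 (Nat.succ_le_of_lt hi)),
      ← one_mul (1 : R), ← monomial_mul, ← X_pow_eq_monomial]
    exact Ideal.mul_mem_left _ _ (hsq i)
  obtain ⟨b, hab, hb⟩ := hS.exists_le_maximal ha
  refine ⟨b, hab, hb.prop, fun i => by_contra fun hi => ?_⟩
  rw [X, monomial_mul, one_mul] at hi
  have hle := hb.le_of_ge hi le_add_self i
  rw [Finsupp.add_apply, Finsupp.single_eq_same] at hle
  omega

variable {V : Type*} {G : SimpleGraph V} {J : Finset (Sym2 V)}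

open Classical in
/-- The exponent vector of the squarefree monomial `∏ f ∈ J, X f`. Elements of `J` that are not
edges of `G` are ignored. -/
def squarefreeExponent (G : SimpleGraph V) (J : Finset (Sym2 V)) : G.edgeSet →₀ ℕ :=
  ∑ f ∈ J.subtype (· ∈ G.edgeSet), Finsupp.single f 1

lemma degree_squarefreeExponent (hJ : (J : Set (Sym2 V)) ⊆ G.edgeSet) :
    (squarefreeExponent G J).degree = J.card := by
  classical
  simp only [squarefreeExponent, map_sum, Finsupp.degree_single, Finset.card_eq_sum_ones]
  exact Finset.sum_subtype_of_mem (fun _ => 1) hJ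

lemma linearCombination_squarefreeExponent {M : Type*} [AddCommMonoid M]
    (hJ : (J : Set (Sym2 V)) ⊆ G.edgeSet) (h : Sym2 V → M) :
    Finsupp.linearCombination ℕ (fun f : G.edgeSet => h f) (squarefreeExponent G J) =
      ∑ f ∈ J, h f := by
  classical
  simp only [squarefreeExponent, map_sum, Finsupp.linearCombination_single, one_smul]
  exact Finset.sum_subtype_of_mem h hJ

/-- The set of edges whose exponent in the monomial with exponent vector `b` is odd. -/
def oddEdges (b : G.edgeSet →₀ ℕ) : Finset (Sym2 V) :=
  (b.support.filter fun f => Odd (b f)).map (.subtype _)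

lemma coe_mem_oddEdges {b : G.edgeSet →₀ ℕ} {f : G.edgeSet} :
    (f : Sym2 V) ∈ oddEdges b ↔ Odd (b f) := by
  refine (Finset.mem_map' (.subtype _)).trans ?_
  rw [Finset.mem_filter, Finsupp.mem_support_iff, and_iff_right_iff_imp]
  exact fun hodd => hodd.pos.ne'

lemma oddEdges_subset (b : G.edgeSet →₀ ℕ) : (oddEdges b : Set (Sym2 V)) ⊆ G.edgeSet := fun _ hf =>
  Finset.property_of_mem_map_subtype _ hf

lemma linearCombination_eq_sum_oddEdges {M : Type*} [AddCommGroup M] [Module (ZMod 2) M]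
    (h : Sym2 V → M) (b : G.edgeSet →₀ ℕ) :
    Finsupp.linearCombination ℕ (fun f : G.edgeSet => h f) b = ∑ f ∈ oddEdges b, h f := by
  rw [oddEdges, Finset.sum_map, Finset.sum_filter, Finsupp.linearCombination_apply,
    Finsupp.sum]
  refine Finset.sum_congr rfl fun f _ => ?_
  rw [← Nat.cast_smul_eq_nsmul (ZMod 2) (b f)]
  split_ifs with hodd
  · rw [ZMod.natCast_eq_one_iff_odd.2 hodd, one_smul, Function.Embedding.subtype_apply]
  · rw [ZMod.natCast_eq_zero_iff_even.2 (Nat.not_odd_iff_even.1 hodd), zero_smul]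

lemma card_oddEdges_add_le [DecidableEq V] {b : G.edgeSet →₀ ℕ} {e : G.edgeSet} (he : b e ≠ 0) :
    (oddEdges b).card + (if (e : Sym2 V) ∈ oddEdges b then 0 else 2) ≤ b.degree := by
  have hparity : ∀ f ∈ b.support, (if Odd (b f) then 1 else 0) ≤ b f := fun f hf => by
    rw [Finsupp.mem_support_iff] at hf
    split_ifs <;> omega
  rw [oddEdges, Finset.card_map, Finset.card_filter, ← oddEdges, Finsupp.degree_apply,
    ← Finset.sum_erase_add _ _ (Finsupp.mem_support_iff.2 he),
    ← Finset.sum_erase_add _ _ (Finsupp.mem_support_iff.2 he), add_assoc]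
  refine Nat.add_le_add (Finset.sum_le_sum fun f hf => hparity f (Finset.mem_of_mem_erase hf)) ?_
  simp only [coe_mem_oddEdges]
  split_ifs with hodd
  · omega
  · have := Nat.not_odd_iff_even.1 hodd
    grind

variable {K : Type*} [Field K]

/-- A monomial divisible by `X e` with the same class as the squarefree monomial of `J \ {e}` would
have a larger degree, by `IsJoin.card_erase_add_le` applied to its edges with odd exponent. -/
lemma IsJoin.monomial_squarefreeExponent_notMem [DecidableEq V] (hJ : IsJoin G J) {e : G.edgeSet}
    (he : (e : Sym2 V) ∈ J) :
    monomial (squarefreeExponent G (J.erase e)) 1 ∉ graphIdeal K G ⊔ variableIdeal K {e} := by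
  intro hmem
  have hJe : (J.erase e : Set (Sym2 V)) ⊆ G.edgeSet :=
    (Finset.coe_subset.2 (J.erase_subset _)).trans hJ.1
  obtain ⟨g, hg, h, hh, hgh⟩ := Submodule.mem_sup.1 hmem
  have htoric := congrArg (toricMap K fun f : G.edgeSet => edgeClass f.1) hgh
  rw [map_add, mem_graphIdeal_iff.1 hg, zero_add, toricMap_monomial] at htoric
  obtain ⟨b, hb, hclass⟩ := exists_mem_support_of_coeff_toricMap_ne_zero (f := h) <| by
    rw [htoric, AddMonoidAlgebra.coeff_single, Finsupp.single_eq_same]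
    exact one_ne_zero
  obtain ⟨_, rfl, hbe⟩ := mem_variableIdeal.1 hh b hb
  obtain ⟨hdegree, hvector⟩ := Prod.ext_iff.1 <|
    (linearCombination_prodMk_const 2 _ b).symm.trans <|
      hclass.trans (linearCombination_prodMk_const 2 _ _)
  rw [degree_squarefreeExponent hJe] at hdegree
  rw [linearCombination_eq_sum_oddEdges edgeVector,
    linearCombination_squarefreeExponent hJe edgeVector] at hvector
  have hcard := hJ.card_erase_add_le he (oddEdges_subset b) hvector
  have hodd := card_oddEdges_add_le hbe
  simp only [nsmul_eq_mul] at hdegree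
  split_ifs at hcard hodd <;> omega

theorem IsJoin.card_le_idealRegularity [Finite G.edgeSet] (hJ : IsJoin G J)
    (hJ_nonempty : J.Nonempty) : (J.card : EReal) ≤ idealRegularity (graphIdeal K G) := by
  classical
  obtain ⟨e', he⟩ := hJ_nonempty
  obtain ⟨e, rfl⟩ : ∃ e : G.edgeSet, e = e' := ⟨⟨e', hJ.1 he⟩, rfl⟩
  have hsq : ∀ f, X f ^ 2 ∈ graphIdeal K G ⊔ variableIdeal K {e} := fun f => by
    rw [← sub_add_cancel (X f ^ 2) (X e ^ 2)]
    exact Submodule.add_mem_sup (X_sq_sub_X_sq_mem_graphIdeal f e)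
      (Ideal.pow_mem_of_mem _ (X_mem_variableIdeal (Set.mem_singleton e)) 2 two_pos)
  obtain ⟨b, hle, hb_notMem, hb_socle⟩ :=
    exists_monomial_socle hsq (hJ.monomial_squarefreeExponent_notMem (K := K) he)
  have hcard : J.card ≤ b.degree + 1 := by
    rw [← Finset.card_erase_add_one he, ← degree_squarefreeExponent
      ((Finset.coe_subset.2 (J.erase_subset _)).trans hJ.1)]
    exact Nat.add_le_add_right (Finsupp.degree_mono hle) 1
  refine le_trans (mod_cast hcard) <| succ_le_idealRegularity_of_socle
    (fun _ hf j => homogeneousComponent_mem_graphIdeal hf j)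
    (fun _ => mem_graphIdeal_of_X_mul_mem) (isHomogeneous_monomial 1 rfl) hb_notMem hb_socle

end Socle

end JoinReg

end

theorem mainTheorem2_general {V : Type*} (K : Type*) [Field K] (G : SimpleGraph V)
    [Finite G.edgeSet] :
    (JoinReg.maxJoinNumber G : EReal) ≤ JoinReg.idealRegularity (JoinReg.graphIdeal K G) := by
  obtain ⟨J, hJ, hcard⟩ := JoinReg.exists_isJoin_card_eq_maxJoinNumber G
  rw [← hcard]
  obtain rfl | hJ_nonempty := J.eq_empty_or_nonempty
  · rw [Finset.card_empty, Nat.cast_zero]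
    exact zero_le_one.trans <| JoinReg.one_le_idealRegularity
      (fun _ hf j => JoinReg.homogeneousComponent_mem_graphIdeal hf j) JoinReg.graphIdeal_ne_top
  · exact hJ.card_le_idealRegularity hJ_nonempty

theorem mainTheorem2 {V : Type*} [Finite V] (K : Type*) [Field K] (G : SimpleGraph V)
    (hG : ∀ v : V, ∃ w : V, G.Adj v w) :
    (JoinReg.maxJoinNumber G : EReal) ≤ JoinReg.idealRegularity (JoinReg.graphIdeal K G) :=
  mainTheorem2_general K G
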